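/- **Setting.** A finite MDP $\mathcal M=\langle\mathcal S,\mathcal A,T,R\rangle$ with rewards in $[0,R^{\max}]$ is called ergodic if the chains $T^\pi(s'|s)=\sum_a\pi(a|s)T(s'|s,a)$ of all stationary policies $\pi$ are aperiodic and have a single recurrent class, the same for all $\pi$; $\mu^\pi$ is then the steady-state distribution, and $\pi^*$ denotes a stationary policy of maximal average reward. For $\mathcal R\subseteq\mathcal S$ let $\mu^\pi(\mathcal R)=\sum_{s\in\mathcal R}\mu^\pi(s)$, and let $\partial\mathcal R$ be the set of states of $\mathcal R$ from which $T^\pi$ leaves $\mathcal R$ in one step with positive probability. A region is a nonempty set of states that is connected in the graph joining $s\ne s'$ when $T^\pi(s'|s)+T^\pi(s|s')>0$. The expected residence time $\mathbb E_{\mu^\pi}[t^\pi_{\mathcal R}]$ is the expected length of a single visit to $\mathcal R$ in steady state: the visit starts at $s\in\mathcal R$ with probability proportional to $\sum_{r\notin\mathcal R}\mu^\pi(r)T^\pi(s|r)$ and lasts until the chain leaves $\mathcal R$. (If $\mathcal R$ is never entered in steady state, the value is $0$ by convention.) Further, $D^\pi=\max_{s_0,s_1}\mathbb E_\pi[t_{\rm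 hit}^\pi(s_1|s_0)]$ is the diameter, and $t^\pi_{\rm mix}(\epsilon)=\min\{h:\max_{s_0}d_{\rm TV}(P^\pi(s_h=\cdot|s_0),\mu^\pi)\le\epsilon\}$. A proportional scaling function on $\mathbb R^n$ is a map $\sigma(q,\nu)=q+\nu\Delta q$ with $\Delta q_i\ge0$ for all $i$ and $\Delta q_i>0$ for some $i$. Consider ergodic MDPs $\mathcal M_\nu$, $\nu\ge0$, where $\mathcal M_\nu$ is the MDP with parameter vector $\sigma(q_0,\nu)$, state space $\mathcal S_\nu$ and action set $\mathcal A_\nu$. A scalable region is a choice of a region $\mathcal R_\nu\subseteq\mathcal S_\nu$ of the chain of $\pi^*$ for each $\nu\ge0$ such that $\mu^{\pi^*}(\partial\mathcal R_\nu)<\mu^{\pi^*}(\mathcal R_\nu)$ for $\nu=0$ and for all sufficiently large $\nu$. The family is a scalable MDP if it has a scalable region and $|\mathcal S_\nu|\to\infty$ as $\nu\to\infty$. For a quantity $f$ depending on $\nu$, write $f\in\Omega(|\mathcal S|^k)$ if there are $c>0$ and $\nu_0$ with $f(\nu)\ge c\,|\mathcal S_\nu|^k$ for all $\nu\ge\nu_0$.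 The family has a polynomial mixing time if the mixing dynamics of $\pi^*$ contribute a factor $\Omega(|\mathcal S|^{k})$, for some $k>0$, to the lower bound $\sqrt{D^{\pi^*}|\mathcal S||\mathcal A|H}$ on the $H$-step regret, i.e. for some $k,c>0$, for all sufficiently large $\nu$ and all $H\in\mathbb N$, $\sqrt{D^{\pi^*}|\mathcal S_\nu||\mathcal A_\nu|H}\ge c\,|\mathcal S_\nu|^{k}\sqrt{|\mathcal S_\nu||\mathcal A_\nu|H}$. **Proposition.** Let a scalable MDP contain a scalable region $\mathcal R_\nu$ with $\mathbb E_{\mu^{\pi^*}}[t^{\pi^*}_{\mathcal R_\nu}]\in\Omega(|\mathcal S|^k)$ for some $k>0$. Then it has a polynomial mixing time; more precisely, with the same $k$: 1. $D^{\pi^*}\in\Omega(|\mathcal S|^k)$. 2. If there is $\delta>0$ with $\mu^{\pi^*}(\mathcal R_\nu)\le1-\delta$ for all large $\nu$, then $t^{\pi^*}_{\rm mix}(\epsilon)\in\Omega(|\mathcal S|^k)$ for every $\epsilon\in(0,\tfrac12)$, in particular for the conventional mixing time $t^{\pi^*}_{\rm mix}(\tfrac14)$. 3. For every $\epsilon\in(0,1)$: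 if there is $\delta>0$ with $\mu^{\pi^*}(\mathcal R_\nu)\le1-\epsilon-\delta$ for all large $\nu$, then $t^{\pi^*}_{\rm mix}(\epsilon)\in\Omega(|\mathcal S|^k)$. -/

import Mathlib

open Filter Topology
open scoped ENNReal BigOperators

universe u v

/-! ## Finite Markov chains, given by a transition matrix -/

namespace FinChain

variable {S : Type u} [Fintype S] [DecidableEq S]

/-- `μ` is a steady-state distribution of `P`: a probability vector solving the balance equations.
For an aperiodic chain with one recurrent class it is unique and is the limit of
`P^t s₀` for every `s₀`. -/
structure IsSteadyState (P : Matrix S S ℝ) (μ : S → ℝ) : Prop where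
  nonneg : ∀ s, 0 ≤ μ s
  sum_eq_one : ∑ s, μ s = 1
  balance : ∀ s', ∑ s, μ s * P s s' = μ s'

/-- State `t` can be reached from state `s` (in zero or more steps). -/
def Reaches (P : Matrix S S ℝ) (s t : S) : Prop := ∃ m : ℕ, 0 < (P ^ m) s t

/-- A recurrent class of a finite chain: a nonempty closed communicating class. -/
def IsRecurrentClass (P : Matrix S S ℝ) (C : Set S) : Prop :=
  C.Nonempty ∧ ∀ s ∈ C, ∀ t, Reaches P s t ↔ t ∈ C

/-- The return times to `s` of positive probability have greatest common divisor one. -/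
def IsAperiodicAt (P : Matrix S S ℝ) (s : S) : Prop :=
  ∀ d : ℕ, (∀ m : ℕ, 0 < m → 0 < (P ^ m) s s → d ∣ m) → d = 1

/-- Total variation distance between two distributions on a finite set. -/
noncomputable def tvDist (p q : S → ℝ) : ℝ := (1 / 2) * ∑ s, |p s - q s|

/-- The `ε`-mixing time with respect to `μ`: the least `h` such that the law at time `h` is within
`ε` of `μ` in total variation, from every initial state (`∞` if there is no such `h`). -/
noncomputable def mixingTime (P : Matrix S S ℝ) (μ : S → ℝ) (ε : ℝ) : ℝ≥0∞ :=
  ⨅ (h : ℕ) (_ : ∀ s₀, tvDist ((P ^ h) s₀) μ ≤ ε), (h : ℝ≥0∞)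

/-- The probability, starting from `s`, that the states at times `0, 1, …, t` all lie in `A`. -/
noncomputable def stayProb (P : Matrix S S ℝ) (A : Finset S) : ℕ → S → ℝ
  | 0, s => if s ∈ A then 1 else 0
  | t + 1, s => if s ∈ A then ∑ s', P s s' * stayProb P A t s' else 0

/-- The expected first time `τ ≥ 0` at which the chain started from `s` is outside `A`, that is
`E τ = ∑ t, Pr (τ > t)`. -/
noncomputable def expectedExitTime (P : Matrix S S ℝ) (A : Finset S) (s : S) : ℝ≥0∞ :=
  ∑' t : ℕ, ENNReal.ofReal (stayProb P A t s)

/-- The expected hitting time of `s₁` from `s₀`. -/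
noncomputable def expectedHittingTime (P : Matrix S S ℝ) (s₀ s₁ : S) : ℝ≥0∞ :=
  expectedExitTime P {s₁}ᶜ s₀

/-- The diameter of the chain: the largest expected hitting time between two states. -/
noncomputable def diameter (P : Matrix S S ℝ) : ℝ≥0∞ :=
  ⨆ (s₀ : S) (s₁ : S), expectedHittingTime P s₀ s₁

/-- The steady-state probability of a set of states. -/
def mass (μ : S → ℝ) (A : Finset S) : ℝ := ∑ s ∈ A, μ s

/-- The steady-state probability that the current state is outside `A` and that the next
state is `s`. -/
noncomputable def entryFlow (P : Matrix S S ℝ) (μ : S → ℝ) (A : Finset S) (s : S) : ℝ :=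
  ∑ r ∈ Aᶜ, μ r * P r s

/-- The expected residence time of `A` in steady state: the average time that the chain spends
in `A` during a single visit. The first state of a visit is distributed on `A` proportionally to
`entryFlow`, and the visit lasts until the chain leaves `A`. (The value is `0` by convention
if `A` is never entered in steady state.) -/
noncomputable def residenceTime (P : Matrix S S ℝ) (μ : S → ℝ) (A : Finset S) : ℝ≥0∞ :=
  ∑ s ∈ A, ENNReal.ofReal (entryFlow P μ A s / ∑ s' ∈ A, entryFlow P μ A s') *
    expectedExitTime P A s

open Classical in
/-- The boundary of `A`: the states of `A` from which `A` can be left in one step. -/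
noncomputable def boundary (P : Matrix S S ℝ) (A : Finset S) : Finset S :=
  A.filter fun s => 0 < ∑ s' ∈ Aᶜ, P s s'

/-- The graph of the chain: distinct states `s`, `s'` are adjacent if one of the two transitions
between them has positive probability. -/
def transitionGraph (P : Matrix S S ℝ) : SimpleGraph S :=
  SimpleGraph.fromRel fun s s' => 0 < P s s' + P s' s

/-- A region: a (nonempty) connected set of states. -/
def IsRegion (P : Matrix S S ℝ) (A : Finset S) : Prop :=
  ((transitionGraph P).induce (A : Set S)).Connected

end FinChain

/-! ## Markov decision processes -/

/-- A finite Markov decision process; `T s a s'` is the probability of moving to `s'` when action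
`a` is taken in state `s`, and `R s a` is the reward. -/
structure MDP where
  State : Type u
  Action : Type v
  [fintypeState : Fintype State]
  [decState : DecidableEq State]
  [nonemptyState : Nonempty State]
  [fintypeAction : Fintype Action]
  [nonemptyAction : Nonempty Action]
  T : State → Action → State → ℝ
  T_nonneg : ∀ s a s', 0 ≤ T s a s'
  T_sum : ∀ s a, ∑ s', T s a s' = 1
  R : State → Action → ℝ
  Rmax : ℝ
  R_nonneg : ∀ s a, 0 ≤ R s a
  R_le : ∀ s a, R s a ≤ Rmax

namespace MDP

attribute [instance] fintypeState decState nonemptyState fintypeAction nonemptyAction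

/-- A stationary (possibly randomized) policy. -/
structure Policy (M : MDP.{u, v}) where
  prob : M.State → M.Action → ℝ
  nonneg : ∀ s a, 0 ≤ prob s a
  sum_eq_one : ∀ s, ∑ a, prob s a = 1

/-- The transition matrix of the Markov chain induced by a policy. -/
def chain (M : MDP.{u, v}) (π : M.Policy) : Matrix M.State M.State ℝ :=
  fun s s' => ∑ a, π.prob s a * M.T s a s'

/-- All stationary policies induce aperiodic chains that have a single recurrent class, the same
for all policies. -/
def IsErgodic (M : MDP.{u, v}) : Prop :=
  ∃ C : Set M.State, ∀ π : M.Policy,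
    (∀ C' : Set M.State, FinChain.IsRecurrentClass (M.chain π) C' ↔ C' = C) ∧
    ∀ s ∈ C, FinChain.IsAperiodicAt (M.chain π) s

/-- The expected reward collected at time `t` under `π`, starting from `s₀` at time `0`. -/
def expectedReward (M : MDP.{u, v}) (π : M.Policy) (s₀ : M.State) (t : ℕ) : ℝ :=
  ∑ s, (M.chain π ^ t) s₀ s * ∑ a, π.prob s a * M.R s a

/-- `ρ` is the average reward per step of `π`, from every initial state. -/
def HasAverageReward (M : MDP.{u, v}) (π : M.Policy) (ρ : ℝ) : Prop :=
  ∀ s₀, Tendsto (fun h : ℕ => (1 / (h : ℝ)) * ∑ t ∈ Finset.Icc 1 h, M.expectedReward π s₀ t)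
    atTop (𝓝 ρ)

/-- `π` maximizes the average reward per step among the stationary policies. -/
def IsOptimal (M : MDP.{u, v}) (π : M.Policy) : Prop :=
  ∃ ρ, M.HasAverageReward π ρ ∧ ∀ π' ρ', M.HasAverageReward π' ρ' → ρ' ≤ ρ

/-- The lower bound `√(D^π |S| |A| H)` on the `H`-step regret. -/
noncomputable def regretBound (M : MDP.{u, v}) (π : M.Policy) (H : ℕ) : ℝ≥0∞ :=
  (FinChain.diameter (M.chain π) * Fintype.card M.State * Fintype.card M.Action * H) ^ (1 / 2 : ℝ)

/-- The intrinsic part `√(|S| |A| H)` of the regret bound, without the contribution of mixing. -/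
noncomputable def intrinsicRegretBound (M : MDP.{u, v}) (H : ℕ) : ℝ≥0∞ :=
  ((Fintype.card M.State : ℝ≥0∞) * Fintype.card M.Action * H) ^ (1 / 2 : ℝ)

end MDP

/-! ## Scaling -/

/-- A proportional scaling function on the parameter space `ℝⁿ`: `σ(q, ν) = q + ν Δq`, where no
parameter shrinks and at least one grows. -/
def IsProportionalScaling {n : ℕ} (σ : (Fin n → ℝ) → ℝ → (Fin n → ℝ)) : Prop :=
  ∃ Δq : Fin n → ℝ, (∀ i, 0 ≤ Δq i) ∧ (∃ i, 0 < Δq i) ∧ ∀ q ν, σ q ν = q + ν • Δq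

section Families

variable (C : ℝ → MDP.{u, v})

/-- `f ∈ Ω(|S|^k)` along the family, as the scaling parameter `ν` tends to infinity. -/
def IsOmegaCardPow (k : ℝ) (f : ℝ → ℝ≥0∞) : Prop :=
  ∃ c : ℝ, 0 < c ∧ ∀ᶠ ν in atTop,
    ENNReal.ofReal (c * (Fintype.card (C ν).State : ℝ) ^ k) ≤ f ν

variable (π : ∀ ν, (C ν).Policy) (μ : ∀ ν, (C ν).State → ℝ)

/-- A scalable region: a region of every member of the family that has an interior, as measured
by steady-state probability, initially and as `ν → ∞`. -/
structure IsScalableRegion (R : ∀ ν, Finset (C ν).State) : Prop where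
  region : ∀ ν, 0 ≤ ν → FinChain.IsRegion ((C ν).chain (π ν)) (R ν)
  initial : FinChain.mass (μ 0) (FinChain.boundary ((C 0).chain (π 0)) (R 0))
    < FinChain.mass (μ 0) (R 0)
  limit : ∀ᶠ ν in atTop, FinChain.mass (μ ν) (FinChain.boundary ((C ν).chain (π ν)) (R ν))
    < FinChain.mass (μ ν) (R ν)

/-- The mixing dynamics under `π` contribute a factor `Ω(|S|^k)`, for some `k > 0`, to the lower
bound on regret, uniformly in the horizon `H`. -/
def HasPolynomialMixingTime : Prop :=
  ∃ k : ℝ, 0 < k ∧ ∃ c : ℝ, 0 < c ∧ ∀ᶠ ν in atTop, ∀ H : ℕ,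
    ENNReal.ofReal (c * (Fintype.card (C ν).State : ℝ) ^ k) * (C ν).intrinsicRegretBound H
      ≤ (C ν).regretBound (π ν) H

end Families

/-- A scalable MDP: the family `M_ν = M (σ q₀ ν)`, `ν ≥ 0`, of ergodic MDPs that arises from an
MDP `M q` depending on parameters `q ∈ ℝⁿ` through a proportional scaling function `σ`, has state
spaces whose size tends to infinity, and has a scalable region. Here `π ν` is the
optimal policy of `M_ν`, and `μ ν` its steady-state distribution. -/
structure IsScalableMDP {n : ℕ} (M : (Fin n → ℝ) → MDP.{u, v})
    (σ : (Fin n → ℝ) → ℝ → (Fin n → ℝ)) (q₀ : Fin n → ℝ)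
    (π : ∀ ν, (M (σ q₀ ν)).Policy) (μ : ∀ ν, (M (σ q₀ ν)).State → ℝ) : Prop where
  proportional : IsProportionalScaling σ
  ergodic : ∀ ν, 0 ≤ ν → (M (σ q₀ ν)).IsErgodic
  optimal : ∀ ν, 0 ≤ ν → (M (σ q₀ ν)).IsOptimal (π ν)
  steady : ∀ ν, 0 ≤ ν → FinChain.IsSteadyState ((M (σ q₀ ν)).chain (π ν)) (μ ν)
  card_tendsto : Tendsto (fun ν => Fintype.card (M (σ q₀ ν)).State) atTop atTop
  exists_region : ∃ R, IsScalableRegion (fun ν => M (σ q₀ ν)) π μ R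

/-!
The residence time of a set `A` is an average of expected exit times from states of `A`, so it is
at most the largest of them. That maximum is compared with the diameter and with mixing.

*Diameter.* A nonzero residence time forces some state `r ∉ A` to exist, and the chain cannot hit
`r` before it has left `A`; hence the residence time is at most the diameter
(`residenceTime_le_diameter`).

*Mixing.* Suppose that after `h` steps the chain is within `ε` of its steady state `μ` from every
initial state, and that `μ(A) ≤ 1 - ε - δ`. Then from every state of `A` the chain is in `A` at
time `h` with probability at most `1 - δ`, so it has left `A` by then with probability at
least `δ`. Iterating over blocks of `h` steps bounds the expected exit time, and hence the residence
time, by `h / δ` (`residenceTime_le_of_mixed`).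

*Amplification.* If only `μ(A) ≤ 1 - δ` is known but `ε < 1/2`, then `P ^ h` contracts the `ℓ¹` norm
of vectors of total mass zero by the factor `2ε < 1`, so after `m * h` steps the chain is within
`(2ε) ^ m / 2` of `μ` (`tvDist_pow_mul_le`). For a fixed `m`, depending only on `ε` and `δ`, this is
at most `δ / 2`, and the previous bound applies at time `m * h`.
-/

namespace FinChain

variable {S : Type u} [Fintype S] [DecidableEq S] {P : Matrix S S ℝ} {μ : S → ℝ} {A : Finset S}

/-! ### Probability of staying in a set -/

lemma stayProb_nonneg (hP : ∀ s s', 0 ≤ P s s') (A : Finset S) (t : ℕ) (s : S) :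
    0 ≤ stayProb P A t s := by
  induction t generalizing s with
  | zero => simp only [stayProb]; split_ifs <;> norm_num
  | succ t ih =>
    simp only [stayProb]
    split_ifs
    · exact Finset.sum_nonneg fun s' _ => mul_nonneg (hP s s') (ih s')
    · exact le_rfl

lemma stayProb_eq_zero {s : S} (hs : s ∉ A) (t : ℕ) : stayProb P A t s = 0 := by
  cases t <;> simp [stayProb, hs]

lemma stayProb_mono {B : Finset S} (hP : ∀ s s', 0 ≤ P s s') (hAB : A ⊆ B) (t : ℕ) (s : S) :
    stayProb P A t s ≤ stayProb P B t s := by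
  by_cases hs : s ∈ A
  · induction t generalizing s with
    | zero => simp [stayProb, hs, hAB hs]
    | succ t ih =>
      simp only [stayProb, if_pos hs, if_pos (hAB hs)]
      refine Finset.sum_le_sum fun s' _ => mul_le_mul_of_nonneg_left ?_ (hP s s')
      by_cases hs' : s' ∈ A
      · exact ih s' hs'
      · rw [stayProb_eq_zero hs']
        exact stayProb_nonneg hP B t s'
  · rw [stayProb_eq_zero hs]
    exact stayProb_nonneg hP B t s

lemma stayProb_le_sum_pow (hP : P ∈ Matrix.rowStochastic ℝ S) (A : Finset S) (t : ℕ) (s : S) :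
    stayProb P A t s ≤ ∑ s' ∈ A, (P ^ t) s s' := by
  induction t generalizing s with
  | zero => simp [stayProb, Matrix.one_apply]
  | succ t ih =>
    have hpow := fun t s s' =>
      Matrix.nonneg_of_mem_rowStochastic (pow_mem hP t) (i := s) (j := s')
    simp only [stayProb]
    split_ifs
    · calc ∑ x, P s x * stayProb P A t x
          ≤ ∑ x, P s x * ∑ s' ∈ A, (P ^ t) x s' := Finset.sum_le_sum fun x _ =>
            mul_le_mul_of_nonneg_left (ih x) (Matrix.nonneg_of_mem_rowStochastic hP)
        _ = ∑ s' ∈ A, (P ^ (t + 1)) s s' := by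
            simp only [pow_succ', Matrix.mul_apply, Finset.mul_sum]
            exact Finset.sum_comm
    · exact Finset.sum_nonneg fun s' _ => hpow _ _ _

lemma stayProb_le_one (hP : P ∈ Matrix.rowStochastic ℝ S) (A : Finset S) (t : ℕ) (s : S) :
    stayProb P A t s ≤ 1 :=
  calc stayProb P A t s ≤ ∑ s' ∈ A, (P ^ t) s s' := stayProb_le_sum_pow hP A t s
    _ ≤ ∑ s', (P ^ t) s s' := Finset.sum_le_sum_of_subset_of_nonneg (Finset.subset_univ A)
        fun _ _ _ => Matrix.nonneg_of_mem_rowStochastic (pow_mem hP t)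
    _ = 1 := Matrix.sum_row_of_mem_rowStochastic (pow_mem hP t) s

/-- The Markov property at time `t`, in the form of an upper bound. -/
lemma stayProb_add_le (hP : ∀ s s', 0 ≤ P s s') {h : ℕ} {q : ℝ}
    (hq : ∀ s ∈ A, stayProb P A h s ≤ q) (t : ℕ) (s : S) :
    stayProb P A (t + h) s ≤ q * stayProb P A t s := by
  by_cases hs : s ∈ A
  · induction t generalizing s with
    | zero => simpa [stayProb, hs] using hq s hs
    | succ t ih =>
      rw [Nat.add_right_comm]
      simp only [stayProb, if_pos hs, Finset.mul_sum]
      refine Finset.sum_le_sum fun s' _ => ?_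
      rw [mul_left_comm]
      refine mul_le_mul_of_nonneg_left ?_ (hP s s')
      by_cases hs' : s' ∈ A
      · exact ih s' hs'
      · simp [stayProb_eq_zero hs']
  · simp [stayProb_eq_zero hs]

/-! ### Exit times and residence times -/

lemma expectedExitTime_mono {B : Finset S} (hP : ∀ s s', 0 ≤ P s s') (hAB : A ⊆ B) (s : S) :
    expectedExitTime P A s ≤ expectedExitTime P B s :=
  ENNReal.tsum_le_tsum fun t => ENNReal.ofReal_le_ofReal (stayProb_mono hP hAB t s)

/-- If from every state of `A` the chain leaves `A` within `h` steps with probability at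
least `δ`, then the expected exit time is at most `h / δ`. -/
lemma expectedExitTime_le (hP : P ∈ Matrix.rowStochastic ℝ S) {h : ℕ} {δ : ℝ} (hδ : 0 < δ)
    (hq : ∀ s ∈ A, stayProb P A h s ≤ 1 - δ) (s : S) :
    expectedExitTime P A s ≤ ENNReal.ofReal (h / δ) := by
  have hP0 : ∀ s s', 0 ≤ P s s' := fun _ _ => Matrix.nonneg_of_mem_rowStochastic hP
  have h0 := fun t => stayProb_nonneg hP0 A t s
  refine ENNReal.tsum_le_of_sum_range_le fun N => ?_
  rw [← ENNReal.ofReal_sum_of_nonneg fun t _ => h0 t]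
  refine ENNReal.ofReal_le_ofReal ?_
  -- Splitting off the first `h` terms bounds the partial sum `x` by `h + (1 - δ) * x`; the partial
  -- sums are finite, so this can be solved for `x`.
  have key : ∑ t ∈ Finset.range N, stayProb P A t s
      ≤ h + (1 - δ) * ∑ t ∈ Finset.range N, stayProb P A t s :=
    calc ∑ t ∈ Finset.range N, stayProb P A t s
        ≤ ∑ t ∈ Finset.range (h + N), stayProb P A t s :=
          Finset.sum_le_sum_of_subset_of_nonneg
            (Finset.range_subset_range.2 (Nat.le_add_left N h)) fun t _ _ => h0 t
      _ = ∑ t ∈ Finset.range h, stayProb P A t s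
            + ∑ t ∈ Finset.range N, stayProb P A (t + h) s := by
          rw [Finset.sum_range_add]
          simp only [add_comm h]
      _ ≤ ∑ _t ∈ Finset.range h, (1 : ℝ)
            + ∑ t ∈ Finset.range N, (1 - δ) * stayProb P A t s :=
          add_le_add (Finset.sum_le_sum fun t _ => stayProb_le_one hP A t s)
            (Finset.sum_le_sum fun t _ => stayProb_add_le hP0 hq t s)
      _ = h + (1 - δ) * ∑ t ∈ Finset.range N, stayProb P A t s := by
          simp [Finset.mul_sum]
  rw [le_div_iff₀ hδ]
  linarith

/-- The residence time is an average of exit times, hence bounded by any common bound of them. -/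
lemma residenceTime_le (hP : ∀ s s', 0 ≤ P s s') (hμ : ∀ s, 0 ≤ μ s) {b : ℝ≥0∞}
    (hb : ∀ s ∈ A, expectedExitTime P A s ≤ b) : residenceTime P μ A ≤ b := by
  have hflow : ∀ s, 0 ≤ entryFlow P μ A s := fun s =>
    Finset.sum_nonneg fun r _ => mul_nonneg (hμ r) (hP r s)
  calc residenceTime P μ A
      ≤ ∑ s ∈ A, ENNReal.ofReal (entryFlow P μ A s / ∑ s' ∈ A, entryFlow P μ A s') * b :=
        Finset.sum_le_sum fun s hs => mul_le_mul_right (hb s hs) _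
    _ = ENNReal.ofReal ((∑ s ∈ A, entryFlow P μ A s) / ∑ s' ∈ A, entryFlow P μ A s') * b := by
        rw [← Finset.sum_mul, Finset.sum_div, ENNReal.ofReal_sum_of_nonneg fun s _ =>
          div_nonneg (hflow s) (Finset.sum_nonneg fun s' _ => hflow s')]
    _ ≤ 1 * b := by
        gcongr
        exact ENNReal.ofReal_le_one.2 (div_self_le_one _)
    _ = b := one_mul b

lemma residenceTime_le_diameter (hP : ∀ s s', 0 ≤ P s s') (hμ : ∀ s, 0 ≤ μ s) (A : Finset S) :
    residenceTime P μ A ≤ diameter P := by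
  by_cases hA : ∃ r, r ∉ A
  · obtain ⟨r, hr⟩ := hA
    refine residenceTime_le hP hμ fun s _ => ?_
    have hsub : A ⊆ {r}ᶜ := fun x hx => by
      simp only [Finset.mem_compl, Finset.mem_singleton]
      rintro rfl
      exact hr hx
    exact (expectedExitTime_mono hP hsub s).trans
      (le_iSup₂ (f := fun s₀ s₁ => expectedHittingTime P s₀ s₁) s r)
  · -- Nothing enters the whole space, so its residence time is `0` by convention.
    obtain rfl : A = Finset.univ := by
      push Not at hA
      exact Finset.eq_univ_iff_forall.2 hA
    simp [residenceTime, entryFlow]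

/-! ### Mixing -/

/-- Half the `ℓ¹` distance dominates the difference of the probabilities of any event. -/
lemma sum_le_sum_add_tvDist {p q : S → ℝ} (hpq : ∑ s, p s = ∑ s, q s) (A : Finset S) :
    ∑ s ∈ A, p s ≤ ∑ s ∈ A, q s + tvDist p q := by
  have h1 : ∑ s ∈ A, (p s - q s) ≤ ∑ s ∈ A, |p s - q s| :=
    Finset.sum_le_sum fun s _ => le_abs_self _
  have h2 : -∑ s ∈ Aᶜ, (p s - q s) ≤ ∑ s ∈ Aᶜ, |p s - q s| := by
    rw [← Finset.sum_neg_distrib]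
    exact Finset.sum_le_sum fun s _ => neg_le_abs _
  have h3 := Finset.sum_add_sum_compl A fun s => p s - q s
  have h4 := Finset.sum_add_sum_compl A fun s => |p s - q s|
  simp only [Finset.sum_sub_distrib] at h1 h2 h3
  unfold tvDist
  linarith

/-- If the chain is within `ε` of its steady state at time `h`, and `A` has steady-state mass at
most `1 - ε - δ`, then visits to `A` last at most `h / δ` steps on average. -/
lemma residenceTime_le_of_mixed (hP : P ∈ Matrix.rowStochastic ℝ S) (hμ : IsSteadyState P μ)
    {h : ℕ} {ε δ : ℝ} (hδ : 0 < δ) (hA : mass μ A ≤ 1 - ε - δ)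
    (hmix : ∀ s₀, tvDist ((P ^ h) s₀) μ ≤ ε) :
    residenceTime P μ A ≤ ENNReal.ofReal (h / δ) := by
  refine residenceTime_le (fun _ _ => Matrix.nonneg_of_mem_rowStochastic hP) hμ.nonneg fun s _ =>
    expectedExitTime_le hP hδ (fun s _ => ?_) s
  have hsum : ∑ s', (P ^ h) s s' = ∑ s', μ s' := by
    rw [Matrix.sum_row_of_mem_rowStochastic (pow_mem hP h) s, hμ.sum_eq_one]
  have h1 := stayProb_le_sum_pow hP A h s
  have h2 := sum_le_sum_add_tvDist hsum A
  have h3 := hmix s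
  unfold mass at hA
  linarith

lemma IsSteadyState.balance_pow (hμ : IsSteadyState P μ) (t : ℕ) (s' : S) :
    ∑ s, μ s * (P ^ t) s s' = μ s' := by
  induction t generalizing s' with
  | zero => simp [Matrix.one_apply]
  | succ t ih =>
    calc ∑ s, μ s * (P ^ (t + 1)) s s'
        = ∑ x, (∑ s, μ s * (P ^ t) s x) * P x s' := by
          simp only [pow_succ, Matrix.mul_apply, Finset.mul_sum, Finset.sum_mul, mul_assoc]
          exact Finset.sum_comm
      _ = μ s' := by simp only [ih, hμ.balance]

/-- A kernel whose rows are all within `ε` of one distribution contracts the `ℓ¹` norm of vectors of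
total mass zero by the factor `2ε`. -/
lemma sum_abs_sum_mul_le {S : Type u} [Fintype S] {Q : Matrix S S ℝ} {μ : S → ℝ} {ε : ℝ}
    (hQ : ∀ s, tvDist (Q s) μ ≤ ε) {v : S → ℝ} (hv : ∑ s, v s = 0) :
    ∑ s', |∑ s, v s * Q s s'| ≤ 2 * ε * ∑ s, |v s| := by
  -- Since `v` has total mass zero, `μ` may be subtracted from every row.
  have hsub : ∀ s', ∑ s, v s * Q s s' = ∑ s, v s * (Q s s' - μ s') := fun s' => by
    simp only [mul_sub, Finset.sum_sub_distrib, ← Finset.sum_mul, hv, zero_mul, sub_zero]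
  calc ∑ s', |∑ s, v s * Q s s'|
      ≤ ∑ s', ∑ s, |v s| * |Q s s' - μ s'| := Finset.sum_le_sum fun s' _ => by
        rw [hsub]
        simpa only [abs_mul] using
          Finset.abs_sum_le_sum_abs (fun s => v s * (Q s s' - μ s')) Finset.univ
    _ = ∑ s, |v s| * ∑ s', |Q s s' - μ s'| := by
        rw [Finset.sum_comm]
        simp only [Finset.mul_sum]
    _ ≤ ∑ s, |v s| * (2 * ε) := Finset.sum_le_sum fun s _ => by
        refine mul_le_mul_of_nonneg_left ?_ (abs_nonneg _)
        have := hQ s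
        unfold tvDist at this
        linarith
    _ = 2 * ε * ∑ s, |v s| := by rw [← Finset.sum_mul, mul_comm]

/-- Once the chain is within `ε` of its steady state, the distance decays geometrically with
ratio `2ε` along multiples of that time. -/
lemma tvDist_pow_mul_le (hP : P ∈ Matrix.rowStochastic ℝ S) (hμ : IsSteadyState P μ) {h : ℕ}
    {ε : ℝ} (hε : 0 ≤ ε) (hmix : ∀ s₀, tvDist ((P ^ h) s₀) μ ≤ ε) (m : ℕ) (s₀ : S) :
    tvDist ((P ^ ((m + 1) * h)) s₀) μ ≤ (2 * ε) ^ (m + 1) / 2 := by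
  induction m with
  | zero => simpa using hmix s₀
  | succ m ih =>
    set n := (m + 1) * h
    have hsum : ∑ s, ((P ^ n) s₀ s - μ s) = 0 := by
      rw [Finset.sum_sub_distrib, Matrix.sum_row_of_mem_rowStochastic (pow_mem hP n) s₀,
        hμ.sum_eq_one, sub_self]
    have hstep : ∀ s', (P ^ ((m + 1 + 1) * h)) s₀ s' - μ s'
        = ∑ s, ((P ^ n) s₀ s - μ s) * (P ^ h) s s' := fun s' => by
      rw [add_one_mul, pow_add, Matrix.mul_apply]
      simp only [sub_mul, Finset.sum_sub_distrib, hμ.balance_pow, n]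
    have hcontr := sum_abs_sum_mul_le hmix hsum
    have hbound : 2 * ε * ∑ s, |(P ^ n) s₀ s - μ s| ≤ 2 * ε * (2 * ε) ^ (m + 1) := by
      refine mul_le_mul_of_nonneg_left ?_ (by positivity)
      unfold tvDist at ih
      linarith
    unfold tvDist
    simp only [hstep]
    rw [pow_succ' _ (m + 1)]
    linarith

end FinChain

/-! ### Families of Markov decision processes -/

lemma MDP.chain_mem_rowStochastic (M : MDP.{u, v}) (π : M.Policy) :
    M.chain π ∈ Matrix.rowStochastic ℝ M.State := by
  refine Matrix.mem_rowStochastic_iff_sum.2 ⟨fun s s' => ?_, fun s => ?_⟩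
  · exact Finset.sum_nonneg fun a _ => mul_nonneg (π.nonneg s a) (M.T_nonneg s a s')
  · simp only [MDP.chain]
    rw [Finset.sum_comm]
    simp only [← Finset.mul_sum, M.T_sum, mul_one, π.sum_eq_one]

section Families

variable {C : ℝ → MDP.{u, v}} {π : ∀ ν, (C ν).Policy} {k : ℝ}

lemma IsOmegaCardPow.mono {f g : ℝ → ℝ≥0∞} (hf : IsOmegaCardPow C k f)
    (hfg : ∀ᶠ ν in atTop, f ν ≤ g ν) : IsOmegaCardPow C k g := by
  obtain ⟨c, hc, hf⟩ := hf
  refine ⟨c, hc, ?_⟩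
  filter_upwards [hf, hfg] with ν h1 h2 using h1.trans h2

/-- If `f` is at most a constant multiple of every sufficiently mixed time `h`, then a lower bound
on `f` passes to the mixing time. -/
lemma IsOmegaCardPow.mixingTime {f : ℝ → ℝ≥0∞} (hf : IsOmegaCardPow C k f)
    {μ : ∀ ν, (C ν).State → ℝ} {ε b : ℝ} (hb : 0 < b)
    (hmix : ∀ᶠ ν in atTop, ∀ h : ℕ,
      (∀ s₀, FinChain.tvDist (((C ν).chain (π ν) ^ h) s₀) (μ ν) ≤ ε) →
        f ν ≤ ENNReal.ofReal (b * h)) :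
    IsOmegaCardPow C k (fun ν => FinChain.mixingTime ((C ν).chain (π ν)) (μ ν) ε) := by
  obtain ⟨c, hc, hf⟩ := hf
  refine ⟨c / b, by positivity, ?_⟩
  filter_upwards [hf, hmix] with ν h1 h2
  refine le_iInf₂ fun h hh => ?_
  have h3 := (ENNReal.ofReal_le_ofReal_iff (by positivity)).1 (h1.trans (h2 h hh))
  rw [← ENNReal.ofReal_natCast h]
  refine ENNReal.ofReal_le_ofReal ?_
  rw [div_mul_eq_mul_div, div_le_iff₀ hb]
  linarith

/-- The regret bound depends on the diameter through its square root, so a diameter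
in `Ω(|S|^k)` contributes a factor `Ω(|S|^(k/2))`. -/
lemma hasPolynomialMixingTime_of_diameter (hk : 0 < k)
    (hD : IsOmegaCardPow C k fun ν => FinChain.diameter ((C ν).chain (π ν))) :
    HasPolynomialMixingTime C π := by
  obtain ⟨c, hc, hD⟩ := hD
  refine ⟨k / 2, by positivity, c ^ (1 / 2 : ℝ), by positivity, ?_⟩
  filter_upwards [hD] with ν hν H
  have hroot : ENNReal.ofReal (c ^ (1 / 2 : ℝ) * (Fintype.card (C ν).State : ℝ) ^ (k / 2))
      = ENNReal.ofReal (c * (Fintype.card (C ν).State : ℝ) ^ k) ^ (1 / 2 : ℝ) := by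
    rw [ENNReal.ofReal_rpow_of_nonneg (by positivity) (by norm_num),
      Real.mul_rpow hc.le (by positivity), ← Real.rpow_mul (by positivity)]
    congr 3
    ring
  rw [hroot, MDP.intrinsicRegretBound, MDP.regretBound,
    ← ENNReal.mul_rpow_of_nonneg _ _ (by norm_num)]
  refine ENNReal.rpow_le_rpow ?_ (by norm_num)
  simp only [← mul_assoc]
  gcongr

end Families

theorem proposition2 {n : ℕ} (M : (Fin n → ℝ) → MDP.{u, v})
    (σ : (Fin n → ℝ) → ℝ → (Fin n → ℝ)) (q₀ : Fin n → ℝ)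
    (π : ∀ ν, (M (σ q₀ ν)).Policy) (μ : ∀ ν, (M (σ q₀ ν)).State → ℝ)
    (hscal : IsScalableMDP M σ q₀ π μ)
    (R : ∀ ν, Finset (M (σ q₀ ν)).State)
    (hR : IsScalableRegion (fun ν => M (σ q₀ ν)) π μ R)
    (k : ℝ) (hk : 0 < k)
    (hres : IsOmegaCardPow (fun ν => M (σ q₀ ν)) k
      (fun ν => FinChain.residenceTime ((M (σ q₀ ν)).chain (π ν)) (μ ν) (R ν))) :
    HasPolynomialMixingTime (fun ν => M (σ q₀ ν)) π ∧
    IsOmegaCardPow (fun ν => M (σ q₀ ν)) k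
      (fun ν => FinChain.diameter ((M (σ q₀ ν)).chain (π ν))) ∧
    ((∃ δ : ℝ, 0 < δ ∧ ∀ᶠ ν in atTop, FinChain.mass (μ ν) (R ν) ≤ 1 - δ) →
      ∀ ε : ℝ, 0 < ε → ε < 1 / 2 →
        IsOmegaCardPow (fun ν => M (σ q₀ ν)) k
          (fun ν => FinChain.mixingTime ((M (σ q₀ ν)).chain (π ν)) (μ ν) ε)) ∧
    (∀ ε : ℝ, 0 < ε → ε < 1 →
      (∃ δ : ℝ, 0 < δ ∧ ∀ᶠ ν in atTop, FinChain.mass (μ ν) (R ν) ≤ 1 - ε - δ) →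
        IsOmegaCardPow (fun ν => M (σ q₀ ν)) k
          (fun ν => FinChain.mixingTime ((M (σ q₀ ν)).chain (π ν)) (μ ν) ε)) := by
  have hsteady : ∀ᶠ ν : ℝ in atTop,
      FinChain.IsSteadyState ((M (σ q₀ ν)).chain (π ν)) (μ ν) := by
    filter_upwards [eventually_ge_atTop 0] with ν hν using hscal.steady ν hν
  have hD : IsOmegaCardPow (fun ν => M (σ q₀ ν)) k
      (fun ν => FinChain.diameter ((M (σ q₀ ν)).chain (π ν))) := by
    refine hres.mono ?_
    filter_upwards [hsteady] with ν hμ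
    exact FinChain.residenceTime_le_diameter (fun _ _ => Matrix.nonneg_of_mem_rowStochastic
      (MDP.chain_mem_rowStochastic _ _)) hμ.nonneg _
  refine ⟨hasPolynomialMixingTime_of_diameter hk hD, hD, ?_, ?_⟩
  · rintro ⟨δ, hδ, hmass⟩ ε hε hε2
    -- After `m + 1` blocks of an `ε`-mixed time the distance to `μ` is at most `δ / 2`.
    obtain ⟨m, hm⟩ := exists_pow_lt_of_lt_one hδ (show 2 * ε < 1 by linarith)
    have hm' : (2 * ε) ^ (m + 1) / 2 ≤ δ / 2 := by
      have := pow_le_pow_of_le_one (by positivity) (by linarith : 2 * ε ≤ 1) (Nat.le_add_right m 1)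
      linarith
    refine hres.mixingTime (b := (m + 1) / (δ / 2)) (by positivity) ?_
    filter_upwards [hsteady, hmass] with ν hμ hA h hh
    have hP := MDP.chain_mem_rowStochastic _ (π ν)
    refine (FinChain.residenceTime_le_of_mixed hP hμ (h := (m + 1) * h) (ε := δ / 2)
      (δ := δ / 2) (by positivity) (by linarith) fun s₀ =>
        (FinChain.tvDist_pow_mul_le hP hμ hε.le hh m s₀).trans hm').trans_eq ?_
    push_cast
    rw [div_mul_eq_mul_div]
  · rintro ε - - ⟨δ, hδ, hmass⟩
    refine hres.mixingTime (b := 1 / δ) (by positivity) ?_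
    filter_upwards [hsteady, hmass] with ν hμ hA h hh
    refine (FinChain.residenceTime_le_of_mixed (MDP.chain_mem_rowStochastic _ (π ν)) hμ hδ
      hA hh).trans_eq ?_
    rw [one_div_mul_eq_div]
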